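/- Let $N\ge 0$ and let $\mathfrak g$ be a real Lie algebra of Hermitian $N\times N$ complex matrices, i.e. a real linear space of Hermitian matrices closed under the bracket $[X,Y]_{\mathrm H}:=i(XY-YX)$ (equivalently, $i\mathfrak g$ is a Lie subalgebra of $\mathfrak u(N)$; the case $N=2^n$ is that of $n$ qubits). Let $\langle\cdot,\cdot\rangle$ be a non-degenerate real bilinear form on $\mathfrak g$ that is invariant, $\langle [X,Y]_{\mathrm H},Z\rangle=-\langle Y,[X,Z]_{\mathrm H}\rangle$. Let $\mathfrak g=\mathfrak k\oplus\mathfrak m$ be a Cartan decomposition, i.e. a direct sum of real subspaces, orthogonal for $\langle\cdot,\cdot\rangle$, with $$[\mathfrak k,\mathfrak k]_{\mathrm H}\subseteq\mathfrak k,\qquad [\mathfrak m,\mathfrak m]_{\mathrm H}\subseteq\mathfrak k,\qquad [\mathfrak k,\mathfrak m]_{\mathrm H}\subseteq\mathfrak m,$$ and let $\mathfrak h$ be a Cartan subalgebra, i.e. a maximal Abelian subalgebra within $\mathfrak m$. Let $e^{i\mathfrak k}$ denote the Lie group generated via the exponential map, i.e. the group of unitary matrices generated by the exponentials $e^{iX}$,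 $X\in\mathfrak k$. Then for every $m\in\mathfrak m$ there exist $K\in e^{i\mathfrak k}$ and $h\in\mathfrak h$ such that $$m=K\,h\,K^\dagger .$$ Moreover, with the same $K$ and $h$, one has $e^{-imt}=K\,e^{-iht}\,K^\dagger$ for all $t\in\mathbb R$. In particular, for a Hamiltonian $\mathcal H\in\mathfrak m$ the time evolution is $U(t)=e^{-i\mathcal Ht}=K\,e^{-iht}\,K^\dagger$, where $K$ and $h$ do not depend on $t$. -/

import Mathlib

/-- The real vector space of Hermitian complex matrices with index set `ι`. -/
abbrev HermitianMatrix (ι : Type*) [Fintype ι] [DecidableEq ι] : Type _ :=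
  selfAdjoint (Matrix ι ι ℂ)

section HermitianLie

variable {ι : Type*} [Fintype ι] [DecidableEq ι]

/-- The Lie bracket of Hermitian matrices, `i (X Y - Y X)`. The map `X ↦ -i X` identifies it with
the commutator of skew-Hermitian matrices. -/
instance HermitianMatrix.instBracket : Bracket (HermitianMatrix ι) (HermitianMatrix ι) where
  bracket X Y := ⟨Complex.I • ((X : Matrix ι ι ℂ) * (Y : Matrix ι ι ℂ)
      - (Y : Matrix ι ι ℂ) * (X : Matrix ι ι ℂ)), by
    have hX : star (X : Matrix ι ι ℂ) = X := X.2
    have hY : star (Y : Matrix ι ι ℂ) = Y := Y.2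
    rw [selfAdjoint.mem_iff, star_smul, star_sub, star_mul, star_mul, hX, hY]
    simp only [Complex.star_def, Complex.conj_I, neg_smul, smul_sub]
    abel⟩

theorem HermitianMatrix.coe_lie (X Y : HermitianMatrix ι) :
    ((⁅X, Y⁆ : HermitianMatrix ι) : Matrix ι ι ℂ) =
      Complex.I • ((X : Matrix ι ι ℂ) * (Y : Matrix ι ι ℂ)
        - (Y : Matrix ι ι ℂ) * (X : Matrix ι ι ℂ)) :=
  rfl

instance HermitianMatrix.instLieRing : LieRing (HermitianMatrix ι) where
  add_lie X Y Z := by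
    apply Subtype.ext
    simp only [HermitianMatrix.coe_lie, AddSubgroup.coe_add, add_mul, mul_add, smul_sub, smul_add]
    abel
  lie_add X Y Z := by
    apply Subtype.ext
    simp only [HermitianMatrix.coe_lie, AddSubgroup.coe_add, add_mul, mul_add, smul_sub, smul_add]
    abel
  lie_self X := by
    apply Subtype.ext
    simp [HermitianMatrix.coe_lie]
  leibniz_lie X Y Z := by
    apply Subtype.ext
    simp only [HermitianMatrix.coe_lie, AddSubgroup.coe_add, mul_sub, sub_mul, smul_sub,
      mul_smul_comm, smul_mul_assoc, mul_assoc]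
    abel

noncomputable instance HermitianMatrix.instLieAlgebra : LieAlgebra ℝ (HermitianMatrix ι) where
  lie_smul t X Y := by
    apply Subtype.ext
    simp only [HermitianMatrix.coe_lie, selfAdjoint.val_smul, mul_smul_comm, smul_mul_assoc,
      smul_sub, smul_comm t Complex.I]

end HermitianLie

/-- `L = 𝔨 ⊕ 𝔪` is a Cartan decomposition of the Lie algebra `L`, orthogonal for the bilinear
form `B`. -/
structure IsCartanDecomposition {L : Type*} [LieRing L] [LieAlgebra ℝ L]
    (B : LinearMap.BilinForm ℝ L) (𝔨 𝔪 : Submodule ℝ L) : Prop where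
  isCompl : IsCompl 𝔨 𝔪
  orthogonal : ∀ x ∈ 𝔨, ∀ y ∈ 𝔪, B x y = 0 ∧ B y x = 0
  lie_mem_of_mem_of_mem : ∀ x ∈ 𝔨, ∀ y ∈ 𝔨, ⁅x, y⁆ ∈ 𝔨
  lie_mem_of_mem_compl_of_mem_compl : ∀ x ∈ 𝔪, ∀ y ∈ 𝔪, ⁅x, y⁆ ∈ 𝔨
  lie_mem_compl : ∀ x ∈ 𝔨, ∀ y ∈ 𝔪, ⁅x, y⁆ ∈ 𝔪

/-- `𝔥` is a Cartan subalgebra of the decomposition with second summand `𝔪`: a maximal Abelian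
subalgebra within `𝔪`. (A subspace on which the bracket vanishes is a subalgebra.) -/
def IsCartanSubalgebraIn {L : Type*} [LieRing L] [LieAlgebra ℝ L] (𝔪 𝔥 : Submodule ℝ L) : Prop :=
  Maximal (fun 𝔞 : Submodule ℝ L => 𝔞 ≤ 𝔪 ∧ ∀ x ∈ 𝔞, ∀ y ∈ 𝔞, ⁅x, y⁆ = 0) 𝔥

/-- The Lie group `e^{i𝔨}` generated via the exponential map: the group of unitary matrices
generated by the exponentials `e^{iX}` with `X ∈ 𝔨`, i.e. the connected Lie group of `𝔨`. -/
def expGroup {ι : Type*} [Fintype ι] [DecidableEq ι] {𝔤 : LieSubalgebra ℝ (HermitianMatrix ι)}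
    (𝔨 : Submodule ℝ 𝔤) : Subgroup (Matrix.unitaryGroup ι ℂ) :=
  Subgroup.closure {U | ∃ X ∈ 𝔨,
    (U : Matrix ι ι ℂ) = NormedSpace.exp (Complex.I • ((X : HermitianMatrix ι) : Matrix ι ι ℂ))}

/-! The argument is variational. Choose `v ∈ 𝔥` so generic that whatever commutes with `v` commutes
with all of `𝔥` (`Submodule.exists_commutant_eq`). The closure of the orbit of `m` under `e^{i𝔨}` is
compact, as it lies in a unitary orbit; let `x` maximize `Re tr(xv)` there. Criticality says `Re
tr(i[X,x]v) = 0` for all `X ∈ 𝔨`, and `X = i[x,v]` turns this into `tr(X²) = 0`. So `x` commutes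
with `v`, hence with `𝔥`, and lies in `𝔥` by maximality (`Matrix.exists_mem_closure_orbit_commute`).

A group generated by exponentials need not be closed, so `x` must still be shown to lie in the orbit
itself (`Matrix.exists_mem_conj_of_mem_closure`). Since `𝔪` is the sum of `[𝔨,x]` and the
centralizer of `x` in `𝔪`, a submersion argument conjugates each orbit point near `x` to some `z`
near `x` that commutes with `x`. Points of the orbit closure are unitarily conjugate, so `z` and `x`
have the same spectrum, and eigenvalues being discrete, `z = x`. -/

open Matrix Filter Topology

/-! ### Commuting endomorphisms and generic combinations. -/

section LinearAlgebra

variable {V : Type*} [AddCommGroup V] [Module ℂ V] [FiniteDimensional ℂ V]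

/-- Commuting endomorphisms have a common eigenvector for any prescribed eigenvalue of the first. -/
theorem Module.End.HasEigenvalue.exists_common_eigenvector {A C : Module.End ℂ V}
    (h : Commute A C) {a : ℂ} (ha : A.HasEigenvalue a) :
    ∃ c : ℂ, ∃ u : V, u ≠ 0 ∧ A u = a • u ∧ C u = c • u := by
  have hmap : ∀ u ∈ A.eigenspace a, C u ∈ A.eigenspace a := by
    intro u hu
    rw [Module.End.mem_eigenspace_iff] at hu ⊢
    rw [← Module.End.mul_apply, h.eq, Module.End.mul_apply, hu, map_smul]
  have : Nontrivial (A.eigenspace a) := Submodule.nontrivial_iff_ne_bot.mpr ha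
  obtain ⟨c, hc⟩ := Module.End.exists_eigenvalue (C.restrict hmap)
  obtain ⟨u, hu⟩ := hc.exists_hasEigenvector
  refine ⟨c, u, fun h0 => hu.2 (Subtype.ext h0), Module.End.mem_eigenspace_iff.mp u.2, ?_⟩
  exact congrArg Subtype.val hu.apply_eq_smul

/-- For commuting endomorphisms `A`, `C` with `ker A² = ker A`, the kernel of a generic real
combination `A + t C` is the common kernel. -/
theorem Module.End.exists_real_ker_add_smul_le {A C : Module.End ℂ V} (h : Commute A C)
    (hA : ∀ x, A (A x) = 0 → A x = 0) :
    ∃ t : ℝ, ∀ x, A x + (t : ℂ) • C x = 0 → A x = 0 ∧ C x = 0 := by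
  -- The values of `t` to avoid: zero, and those for which eigenvalues `a` of `A` and `c` of `C`
  -- satisfy `a + t c = 0` with `c ≠ 0`.
  have hfin : Set.Finite ({0} ∪ (fun p : ℂ × ℂ => -p.1 / p.2) ''
      (spectrum ℂ A ×ˢ spectrum ℂ C)) :=
    (Set.finite_singleton _).union
      (((Module.End.finite_spectrum A).prod (Module.End.finite_spectrum C)).image _)
  obtain ⟨t, ht⟩ := ((hfin.preimage
    (Complex.ofReal_injective.injOn)).infinite_compl (α := ℝ)).nonempty
  have ht0 : (t : ℂ) ≠ 0 := fun h0 => ht (Or.inl h0)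
  have key : ∀ x, A x + (t : ℂ) • C x = 0 → A x = 0 := by
    intro x hx
    by_contra hne
    -- `A` is injective on its range because `ker A² = ker A`, so an eigenvalue of `A` on `R` is
    -- nonzero; on `R` it forces the eigenvalue `-a / t` of `C`, which `t` excludes.
    let R : Submodule ℂ V := LinearMap.ker (A + (t : ℂ) • C) ⊓ LinearMap.range A
    have hR : ∀ y ∈ R, A y ∈ R := by
      rintro y ⟨hy, -⟩
      refine ⟨?_, y, rfl⟩
      rw [SetLike.mem_coe, LinearMap.mem_ker] at hy ⊢
      have hc : Commute A (A + (t : ℂ) • C) := (Commute.refl A).add_right (h.smul_right _)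
      rw [← Module.End.mul_apply, ← hc.eq, Module.End.mul_apply, hy, map_zero]
    have hxR : A x ∈ R := by
      refine ⟨?_, x, rfl⟩
      rw [SetLike.mem_coe, LinearMap.mem_ker]
      have hc : Commute A (A + (t : ℂ) • C) := (Commute.refl A).add_right (h.smul_right _)
      rw [← Module.End.mul_apply, ← hc.eq, Module.End.mul_apply]
      change A (A x + (t : ℂ) • C x) = 0
      rw [hx, map_zero]
    have : Nontrivial R := ⟨⟨A x, hxR⟩, 0, fun h0 => hne (congrArg Subtype.val h0)⟩
    obtain ⟨a, ha⟩ := Module.End.exists_eigenvalue (A.restrict hR)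
    obtain ⟨u, hu⟩ := ha.exists_hasEigenvector
    have hAu : A (u : V) = a • (u : V) := congrArg Subtype.val hu.apply_eq_smul
    have hu0 : (u : V) ≠ 0 := fun h0 => hu.2 (Subtype.ext h0)
    have ha0 : a ≠ 0 := by
      rintro rfl
      obtain ⟨z, hz⟩ := u.2.2
      rw [zero_smul, ← hz] at hAu
      exact hu0 (by rw [← hz, hA z hAu])
    have hker : a • (u : V) + (t : ℂ) • C u = 0 := by
      have := u.2.1
      rw [SetLike.mem_coe, LinearMap.mem_ker] at this
      rw [← hAu]
      exact this
    have hCu : C (u : V) = (-a / t) • (u : V) := by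
      rw [div_eq_inv_mul, mul_smul, neg_smul, ← eq_neg_of_add_eq_zero_right hker, smul_smul,
        inv_mul_cancel₀ ht0, one_smul]
    refine ht (Or.inr ⟨(a, -a / t), ⟨?_, ?_⟩, ?_⟩)
    · exact (Module.End.hasEigenvalue_of_hasEigenvector
        ⟨Module.End.mem_eigenspace_iff.mpr hAu, hu0⟩).mem_spectrum
    · exact (Module.End.hasEigenvalue_of_hasEigenvector
        ⟨Module.End.mem_eigenspace_iff.mpr hCu, hu0⟩).mem_spectrum
    · simp only
      field_simp
  refine ⟨t, fun x hx => ⟨key x hx, ?_⟩⟩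
  rw [key x hx, zero_add] at hx
  exact (smul_eq_zero.mp hx).resolve_left ht0

end LinearAlgebra

/-! ### The trace form and commutants of Hermitian matrices. -/

section Commutator

open scoped ComplexOrder

variable {ι : Type*} [Fintype ι]

/-- The form `Re tr(XY)` is positive definite on Hermitian matrices, since `tr(Z²) = tr(ZᴴZ)`. -/
theorem Matrix.IsHermitian.eq_zero_of_re_trace_mul_self {Z : Matrix ι ι ℂ} (hZ : Z.IsHermitian)
    (h : (Z * Z).trace.re = 0) : Z = 0 := by
  rw [← Matrix.trace_conjTranspose_mul_self_eq_zero_iff, hZ.eq]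
  have hH : star (Z * Z).trace = (Z * Z).trace := by
    rw [← Matrix.trace_conjTranspose, Matrix.conjTranspose_mul, hZ.eq]
  refine Complex.ext h ?_
  have := congrArg Complex.im hH
  simp only [Complex.star_def, Complex.conj_im] at this
  simp only [Complex.zero_im]
  linarith

theorem Matrix.IsHermitian.smul_I_commutator {X Y : Matrix ι ι ℂ} (hX : X.IsHermitian)
    (hY : Y.IsHermitian) : (Complex.I • (X * Y - Y * X)).IsHermitian := by
  rw [Matrix.IsHermitian, Matrix.conjTranspose_smul, Matrix.conjTranspose_sub,
    Matrix.conjTranspose_mul, Matrix.conjTranspose_mul, hX.eq, hY.eq, Complex.star_def,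
    Complex.conj_I, neg_smul, ← smul_neg, neg_sub]

theorem Matrix.trace_smul_I_commutator_mul (X Y Z : Matrix ι ι ℂ) :
    ((Complex.I • (X * Y - Y * X)) * Z).trace = (X * (Complex.I • (Y * Z - Z * Y))).trace := by
  rw [smul_mul_assoc, mul_smul_comm, Matrix.trace_smul, Matrix.trace_smul, sub_mul, mul_sub,
    Matrix.trace_sub, Matrix.trace_sub, ← mul_assoc X Y Z, ← mul_assoc X Z Y,
    Matrix.trace_mul_cycle X Z Y]

/-- If `i[Y, Z]` lies in `K` and every `i[X, Y]` with `X ∈ K` is trace-orthogonal to `Z`, then `Y`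
and `Z` commute. -/
theorem Matrix.IsHermitian.commute_of_re_trace {Y Z : Matrix ι ι ℂ} (hY : Y.IsHermitian)
    (hZ : Z.IsHermitian) {K : Set (Matrix ι ι ℂ)} (hK : Complex.I • (Y * Z - Z * Y) ∈ K)
    (h : ∀ X ∈ K, ((Complex.I • (X * Y - Y * X)) * Z).trace.re = 0) : Commute Y Z := by
  -- With `X = i[Y, Z]`, invariance of the trace form turns the hypothesis into `Re tr(X²) = 0`.
  have h0 := h _ hK
  rw [Matrix.trace_smul_I_commutator_mul] at h0
  have := (hY.smul_I_commutator hZ).eq_zero_of_re_trace_mul_self h0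
  exact sub_eq_zero.mp ((smul_eq_zero.mp this).resolve_left Complex.I_ne_zero)

/-- A commuting real subspace of Hermitian matrices contains an element whose commutant is the
commutant of the whole subspace. -/
theorem Submodule.exists_commutant_eq (𝔞 : Submodule ℝ (Matrix ι ι ℂ))
    (hherm : ∀ x ∈ 𝔞, x.IsHermitian) (hcomm : ∀ x ∈ 𝔞, ∀ y ∈ 𝔞, Commute x y) :
    ∃ v ∈ 𝔞, ∀ x, Commute x v → ∀ w ∈ 𝔞, Commute x w := by
  let ad : Matrix ι ι ℂ → Module.End ℂ (Matrix ι ι ℂ) :=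
    fun v => LinearMap.mulLeft ℂ v - LinearMap.mulRight ℂ v
  have had : ∀ v x, ad v x = v * x - x * v := fun v x => rfl
  have hker : ∀ v x, x ∈ LinearMap.ker (ad v) ↔ Commute x v := by
    intro v x
    rw [LinearMap.mem_ker, had, sub_eq_zero]
    exact eq_comm
  -- A generic element is one whose commutant has least dimension.
  obtain ⟨v, hv⟩ : ∃ v : 𝔞, ∀ w : 𝔞, Module.finrank ℂ (LinearMap.ker (ad v)) ≤
      Module.finrank ℂ (LinearMap.ker (ad w)) :=
    ⟨Function.argmin (fun w : 𝔞 => Module.finrank ℂ (LinearMap.ker (ad w))),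
      fun w => Function.argmin_le (fun w : 𝔞 => Module.finrank ℂ (LinearMap.ker (ad w))) w⟩
  refine ⟨v, v.2, fun x hx w hw => ?_⟩
  have hAC : Commute (ad v) (ad w) := by
    refine LinearMap.ext fun z => ?_
    simp only [Module.End.mul_apply, had]
    have := (hcomm v v.2 w hw).eq
    simp only [mul_sub, sub_mul, mul_assoc, this]
    simp only [← mul_assoc, this]
    abel
  -- `ad v` is self-adjoint for the inner product `tr(XᴴY)`, as `v` is Hermitian.
  have hA : ∀ z, ad v (ad v z) = 0 → ad v z = 0 := by
    intro z hz
    have hvH : (v : Matrix ι ι ℂ)ᴴ = v := hherm v v.2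
    rw [← Matrix.trace_conjTranspose_mul_self_eq_zero_iff]
    have : (ad v z)ᴴ = zᴴ * v - v * zᴴ := by
      rw [had, Matrix.conjTranspose_sub, Matrix.conjTranspose_mul, Matrix.conjTranspose_mul, hvH]
    rw [this, sub_mul, Matrix.trace_sub, mul_assoc, mul_assoc, Matrix.trace_mul_comm (v : Matrix ι ι ℂ),
      mul_assoc, ← Matrix.trace_sub, ← mul_sub, ← had v (ad v z), hz, mul_zero, Matrix.trace_zero]
  obtain ⟨t, ht⟩ := Module.End.exists_real_ker_add_smul_le hAC hA
  -- The commutant of `v + t w` lies in that of `v`; minimality makes them equal, so commuting with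
  -- `v` implies commuting with `w`.
  let w' : 𝔞 := v + t • ⟨w, hw⟩
  have hw' : ∀ z, ad w' z = ad v z + (t : ℂ) • ad w z := by
    intro z
    simp only [had, w', Submodule.coe_add, Submodule.coe_smul, add_mul, mul_add, smul_sub,
      smul_mul_assoc, mul_smul_comm, Complex.coe_smul]
    abel
  have hle : LinearMap.ker (ad w') ≤ LinearMap.ker (ad v) := by
    intro z hz
    rw [LinearMap.mem_ker, hw'] at hz
    exact (ht z hz).1
  have heq := Submodule.eq_of_le_of_finrank_le hle (hv w')
  have hxw' : x ∈ LinearMap.ker (ad w') := heq ▸ (hker v x).mpr hx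
  rw [LinearMap.mem_ker, hw'] at hxw'
  exact (hker w x).mp (ht x hxw').2

end Commutator

/-! ### Conjugation by exponentials in a Banach algebra. -/

section BanachAlgebra

variable {𝔸 : Type*} [NormedRing 𝔸] [NormedAlgebra ℝ 𝔸] [CompleteSpace 𝔸]

/-- Conjugation by `exp a` preserves every finite-dimensional subspace invariant under the
commutator with `a`. -/
theorem Submodule.exp_mul_mul_exp_neg_mem (M : Submodule ℝ 𝔸) [FiniteDimensional ℝ M] {a : 𝔸}
    (ha : ∀ y ∈ M, a * y - y * a ∈ M) {y : 𝔸} (hy : y ∈ M) :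
    NormedSpace.exp a * y * NormedSpace.exp (-a) ∈ M := by
  let : NormedAlgebra ℚ (𝔸 →L[ℝ] 𝔸) := .restrictScalars ℚ ℝ _
  -- `L + R` is the commutator with `a`, and `L`, `R` commute, so `exp (L + R)` is conjugation by
  -- `exp a`; its series stays in the closed space `M`.
  let L := ContinuousLinearMap.mul ℝ 𝔸 a
  let R := (ContinuousLinearMap.mul ℝ 𝔸).flip (-a)
  have hLpow : ∀ (n : ℕ) (z : 𝔸), (L ^ n) z = a ^ n * z := by
    intro n
    induction n with
    | zero => simp
    | succ n ih =>
      intro z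
      rw [pow_succ, mul_apply_eq_comp, ih, pow_succ, mul_assoc]
      rfl
  have hRpow : ∀ (n : ℕ) (z : 𝔸), (R ^ n) z = z * (-a) ^ n := by
    intro n
    induction n with
    | zero => simp
    | succ n ih =>
      intro z
      rw [pow_succ, mul_apply_eq_comp, ih, pow_succ', ← mul_assoc]
      rfl
  have hsum : ∀ (T : 𝔸 →L[ℝ] 𝔸) (z : 𝔸),
      HasSum (fun n : ℕ => ((n.factorial : ℝ)⁻¹) • (T ^ n) z) (NormedSpace.exp T z) := fun T z =>
    (NormedSpace.exp_series_hasSum_exp' (𝕂 := ℝ) T).mapL (ContinuousLinearMap.apply ℝ 𝔸 z)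
  have hL : ∀ z, NormedSpace.exp L z = NormedSpace.exp a * z := by
    intro z
    have h2 := (NormedSpace.exp_series_hasSum_exp' (𝕂 := ℝ) a).mul_right z
    simp only [smul_mul_assoc, ← hLpow] at h2
    exact (hsum L z).unique h2
  have hR : ∀ z, NormedSpace.exp R z = z * NormedSpace.exp (-a) := by
    intro z
    have h2 := (NormedSpace.exp_series_hasSum_exp' (𝕂 := ℝ) (-a)).mul_left z
    simp only [mul_smul_comm, ← hRpow] at h2
    exact (hsum R z).unique h2
  have hcomm : Commute R L := ContinuousLinearMap.ext fun z => mul_assoc a z (-a)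
  have hpow : ∀ n : ℕ, ((R + L) ^ n) y ∈ M := by
    intro n
    induction n with
    | zero => simpa
    | succ n ih =>
      rw [pow_succ', mul_apply_eq_comp]
      convert ha _ ih using 1
      change _ * (-a) + a * _ = _
      rw [mul_neg, sub_eq_neg_add]
  have hexp : NormedSpace.exp a * y * NormedSpace.exp (-a) = NormedSpace.exp (R + L) y := by
    rw [NormedSpace.exp_add_of_commute hcomm, mul_apply_eq_comp, hL, hR]
  rw [hexp]
  exact M.closed_of_finiteDimensional.mem_of_tendsto (hsum (R + L) y)
    (Eventually.of_forall fun s => M.sum_mem fun n _ => M.smul_mem _ (hpow n))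

theorem hasDerivAt_exp_smul_conj (a y : 𝔸) :
    HasDerivAt (fun s : ℝ => NormedSpace.exp (s • a) * y * NormedSpace.exp (-(s • a)))
      (a * y - y * a) 0 := by
  have h1 := hasDerivAt_exp_smul_const (𝕂 := ℝ) a 0
  have h2 := hasDerivAt_exp_smul_const (𝕂 := ℝ) (-a) 0
  have h := (h1.mul_const y).mul h2
  simp only [zero_smul, NormedSpace.exp_zero, one_mul, smul_neg, mul_neg, neg_zero, mul_one] at h
  rw [sub_eq_add_neg]
  exact h

theorem hasStrictFDerivAt_exp_conj (y : 𝔸) :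
    HasStrictFDerivAt
      (fun p : 𝔸 × 𝔸 => NormedSpace.exp p.1 * p.2 * NormedSpace.exp (-p.1))
      (ContinuousLinearMap.snd ℝ 𝔸 𝔸 +
        ((ContinuousLinearMap.mul ℝ 𝔸).flip y - ContinuousLinearMap.mul ℝ 𝔸 y) ∘L
          ContinuousLinearMap.fst ℝ 𝔸 𝔸) (0, y) := by
  have hexp : HasStrictFDerivAt (NormedSpace.exp : 𝔸 → 𝔸) (1 : 𝔸 →L[ℝ] 𝔸) 0 :=
    hasStrictFDerivAt_exp_zero
  have hfst : HasStrictFDerivAt (fun p : 𝔸 × 𝔸 => p.1) (ContinuousLinearMap.fst ℝ 𝔸 𝔸) (0, y) :=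
    hasStrictFDerivAt_fst
  have hsnd : HasStrictFDerivAt (fun p : 𝔸 × 𝔸 => p.2) (ContinuousLinearMap.snd ℝ 𝔸 𝔸) (0, y) :=
    hasStrictFDerivAt_snd
  have h2 := HasStrictFDerivAt.comp (0, y) (g := NormedSpace.exp) hexp hfst
  have h3 := HasStrictFDerivAt.comp (f := fun p : 𝔸 × 𝔸 => -p.1) (0, y) (g := NormedSpace.exp)
    (by simpa using hexp) hfst.neg
  refine ((h2.mul' hsnd).mul' h3).congr_fderiv (ContinuousLinearMap.ext fun p => ?_)
  simp
  abel

/-- If `[K, x] + Z = M`, then near `x` every element of `M` is conjugate, under some `exp a` with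
`a ∈ K`, to an element of `Z` near `x`. -/
theorem Submodule.eventually_exists_exp_conj (K M Z : Submodule ℝ 𝔸) [FiniteDimensional ℝ K]
    [FiniteDimensional ℝ M] [FiniteDimensional ℝ Z] (hZM : Z ≤ M)
    (hKM : ∀ a ∈ K, ∀ y ∈ M, a * y - y * a ∈ M) {x : 𝔸} (hx : x ∈ Z)
    (hsurj : ∀ y ∈ M, ∃ a ∈ K, ∃ z ∈ Z, y = (a * x - x * a) + z) {N : Set 𝔸} (hN : N ∈ 𝓝 x) :
    ∀ᶠ y in 𝓝[M] x, ∃ a ∈ K, ∃ z ∈ Z, z ∈ N ∧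
      y = NormedSpace.exp a * z * NormedSpace.exp (-a) := by
  -- Projecting onto `M` leaves the conjugates unchanged but makes `M` the target, where the
  -- derivative is onto.
  obtain ⟨P, hP⟩ := Submodule.ClosedComplemented.of_finiteDimensional (𝕜 := ℝ) M
  let i : K × Z →L[ℝ] 𝔸 × 𝔸 := K.subtypeL.prodMap Z.subtypeL
  have hmem : ∀ p : K × Z,
      NormedSpace.exp (p.1 : 𝔸) * p.2 * NormedSpace.exp (-(p.1 : 𝔸)) ∈ M := fun p =>
    M.exp_mul_mul_exp_neg_mem (hKM _ p.1.2) (hZM p.2.2)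
  let f : K × Z → M := fun p =>
    P (NormedSpace.exp (p.1 : 𝔸) * p.2 * NormedSpace.exp (-(p.1 : 𝔸)))
  have hfc : ∀ p, ((f p : M) : 𝔸) = NormedSpace.exp (p.1 : 𝔸) * p.2 * NormedSpace.exp (-(p.1 : 𝔸)) :=
    fun p => congrArg Subtype.val (hP ⟨_, hmem p⟩)
  have hf : HasStrictFDerivAt f _ ((0 : K), (⟨x, hx⟩ : Z)) :=
    P.hasStrictFDerivAt.comp _ ((hasStrictFDerivAt_exp_conj x).comp ((0 : K), (⟨x, hx⟩ : Z))
      i.hasStrictFDerivAt)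
  have hmap := hf.map_nhds_eq_of_surj (by
    refine LinearMap.range_eq_top.mpr fun y => ?_
    obtain ⟨a, ha, z, hz, hy⟩ := hsurj y y.2
    refine ⟨(⟨a, ha⟩, ⟨z, hz⟩), ?_⟩
    change P (z + (a * x - x * a)) = y
    rw [add_comm, ← hy, hP])
  have hf0 : f ((0 : K), (⟨x, hx⟩ : Z)) = ⟨x, hZM hx⟩ := Subtype.ext (by rw [hfc]; simp)
  rw [hf0] at hmap
  rw [nhdsWithin_eq_map_subtype_coe (hZM hx), eventually_map, ← hmap, eventually_map]
  have hNev : ∀ᶠ p : K × Z in 𝓝 ((0 : K), (⟨x, hx⟩ : Z)), (p.2 : 𝔸) ∈ N :=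
    (continuous_subtype_val.comp continuous_snd).continuousAt.eventually_mem hN
  filter_upwards [hNev] with p hp
  exact ⟨p.1, p.1.2, p.2, p.2.2, hp, hfc p⟩

end BanachAlgebra

/-! ### Spectral rigidity and compactness. -/

section Analysis

variable {ι : Type*} [Fintype ι] [DecidableEq ι]

/-- Near a Hermitian matrix `x` there is no other Hermitian matrix that commutes with `x` and has
the same spectrum. -/
theorem Matrix.IsHermitian.eventually_eq_of_commute_of_spectrum_eq {x : Matrix ι ι ℂ}
    (hx : x.IsHermitian) :
    ∀ᶠ y in 𝓝 x, y.IsHermitian → Commute x y → spectrum ℂ y = spectrum ℂ x → y = x := by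
  open scoped Matrix.Norms.Operator in
  -- `ε` is chosen below every nonzero gap between eigenvalues of `x`. A common eigenvector shows
  -- that a nonzero eigenvalue of `y - x` would be such a gap, yet smaller than `ε`.
  have hfin : ((fun p : ℂ × ℂ => p.1 - p.2) '' (spectrum ℂ x ×ˢ spectrum ℂ x) \ {0}).Finite :=
    ((x.finite_spectrum.prod x.finite_spectrum).image _).subset Set.sdiff_subset
  obtain ⟨ε, hε, hball⟩ := Metric.mem_nhds_iff.mp
    (hfin.isClosed.isOpen_compl.mem_nhds (x := (0 : ℂ)) (fun h => h.2 rfl))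
  filter_upwards [Metric.ball_mem_nhds x hε] with y hy hyH hxy hspec
  by_contra hne
  obtain ⟨u₀, μ, hμ, hu₀, hdu₀⟩ := (hyH.sub hx).exists_eigenvector_of_ne_zero (sub_ne_zero.mpr hne)
  let T : Matrix ι ι ℂ → Module.End ℂ (ι → ℂ) := fun A => Matrix.toLin' A
  have hT : ∀ A u, T A u = A *ᵥ u := fun A u => Matrix.toLin'_apply A u
  have hdx : Commute (T (y - x)) (T x) := by
    have : Commute (y - x) x := hxy.symm.sub_left (Commute.refl x)
    rw [commute_iff_eq, Module.End.mul_eq_comp, Module.End.mul_eq_comp, ← Matrix.toLin'_mul,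
      ← Matrix.toLin'_mul, this.eq]
  have hμ' : (T (y - x)).HasEigenvalue (μ : ℂ) :=
    Module.End.hasEigenvalue_of_hasEigenvector (x := u₀)
      ⟨Module.End.mem_eigenspace_iff.mpr (by rw [hT, hdu₀, Complex.coe_smul]), hu₀⟩
  obtain ⟨c, u, hu, hdu, hxu⟩ := hμ'.exists_common_eigenvector hdx
  rw [hT] at hdu hxu
  have hyu : y *ᵥ u = ((μ : ℂ) + c) • u := by
    rw [add_smul, ← hdu, ← hxu, ← Matrix.add_mulVec, sub_add_cancel]
  have hmem : ∀ {A : Matrix ι ι ℂ} {a : ℂ}, A *ᵥ u = a • u → a ∈ spectrum ℂ A := by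
    intro A a h
    rw [← Matrix.spectrum_toLin']
    exact (Module.End.hasEigenvalue_of_hasEigenvector (x := u)
      ⟨Module.End.mem_eigenspace_iff.mpr (by rw [Matrix.toLin'_apply, h]), hu⟩).mem_spectrum
  have hnorm : ‖(μ : ℂ)‖ * ‖u‖ ≤ ‖y - x‖ * ‖u‖ := by
    rw [← norm_smul, ← hdu]
    exact Matrix.linfty_opNorm_mulVec _ _
  have hlt : ‖(μ : ℂ)‖ < ε :=
    (le_of_mul_le_mul_right hnorm (norm_pos_iff.mpr hu)).trans_lt (by rwa [← dist_eq_norm])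
  refine hball (mem_ball_zero_iff.mpr hlt) ⟨⟨((μ : ℂ) + c, c), ⟨hspec ▸ hmem hyu, hmem hxu⟩, ?_⟩, ?_⟩
  · simp
  · simpa using hμ

theorem Matrix.isCompact_unitaryGroup :
    IsCompact (Matrix.unitaryGroup ι ℂ : Set (Matrix ι ι ℂ)) := by
  have h : IsCompact (Set.univ.pi fun _ : ι => Set.univ.pi fun _ : ι =>
      Metric.closedBall (0 : ℂ) 1) :=
    isCompact_univ_pi fun _ => isCompact_univ_pi fun _ => isCompact_closedBall _ _
  refine h.of_isClosed_subset (isClosed_unitary (R := Matrix ι ι ℂ)) ?_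
  intro U hU i _ j _
  exact mem_closedBall_zero_iff.mpr (entry_norm_bound_of_unitary hU i j)

end Analysis

/-! ### Unitary conjugation and orbit closures. -/

section UnitaryConjugation

variable {ι : Type*} [Fintype ι] [DecidableEq ι]

theorem Matrix.spectrum_unitary_conj (U : Matrix.unitaryGroup ι ℂ) (y : Matrix ι ι ℂ) :
    spectrum ℂ ((U : Matrix ι ι ℂ) * y * (U : Matrix ι ι ℂ)ᴴ) = spectrum ℂ y :=
  Unitary.spectrum_star_right_conjugate (U := U)

theorem Matrix.conjTranspose_eq_exp_neg {U X : Matrix ι ι ℂ} (hX : X.IsHermitian)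
    (hU : U = NormedSpace.exp (Complex.I • X)) : Uᴴ = NormedSpace.exp (-(Complex.I • X)) := by
  rw [hU, ← Matrix.exp_conjTranspose, Matrix.conjTranspose_smul, hX.eq, Complex.star_def,
    Complex.conj_I, neg_smul]

theorem Matrix.IsHermitian.exp_smul_I_mem_unitaryGroup {X : Matrix ι ι ℂ} (hX : X.IsHermitian) :
    NormedSpace.exp (Complex.I • X) ∈ Matrix.unitaryGroup ι ℂ := by
  open scoped Matrix.Norms.Operator in
  rw [Matrix.mem_unitaryGroup_iff, Matrix.star_eq_conjTranspose,
    Matrix.conjTranspose_eq_exp_neg hX rfl,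
    ← Matrix.exp_add_of_commute _ _ (Commute.refl (Complex.I • X)).neg_right, add_neg_cancel,
    NormedSpace.exp_zero]

/-- The limits of a unitary orbit are unitarily conjugate to its base point. -/
theorem Matrix.exists_unitary_conj_of_mem_closure {G : Set (Matrix.unitaryGroup ι ℂ)}
    {x y : Matrix ι ι ℂ}
    (hx : x ∈ closure ((fun U : Matrix.unitaryGroup ι ℂ =>
      (U : Matrix ι ι ℂ) * y * (U : Matrix ι ι ℂ)ᴴ) '' G)) :
    ∃ U : Matrix.unitaryGroup ι ℂ, (U : Matrix ι ι ℂ) * y * (U : Matrix ι ι ℂ)ᴴ = x := by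
  have hcont : Continuous fun U : Matrix ι ι ℂ => U * y * Uᴴ := by fun_prop
  have hc := (Matrix.isCompact_unitaryGroup (ι := ι)).image hcont
  obtain ⟨U, hU, rfl⟩ := closure_minimal (by
    rintro _ ⟨U, -, rfl⟩
    exact ⟨U, U.2, rfl⟩) hc.isClosed hx
  exact ⟨⟨U, hU⟩, rfl⟩

theorem Matrix.isCompact_closure_unitary_orbit (G : Set (Matrix.unitaryGroup ι ℂ))
    (y : Matrix ι ι ℂ) :
    IsCompact (closure ((fun U : Matrix.unitaryGroup ι ℂ =>
      (U : Matrix ι ι ℂ) * y * (U : Matrix ι ι ℂ)ᴴ) '' G)) := by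
  have hcont : Continuous fun U : Matrix ι ι ℂ => U * y * Uᴴ := by fun_prop
  refine ((Matrix.isCompact_unitaryGroup (ι := ι)).image hcont).of_isClosed_subset isClosed_closure ?_
  intro x hx
  obtain ⟨U, hU⟩ := Matrix.exists_unitary_conj_of_mem_closure hx
  exact ⟨U, U.2, hU⟩

end UnitaryConjugation

/-! ### Orbits of a symmetric pair. -/

section SymmetricPair

variable {ι : Type*} [Fintype ι] [DecidableEq ι] {K M : Submodule ℝ (Matrix ι ι ℂ)}

/-- For `x ∈ M`, the space `M` is the sum of `[K, x]` and the centralizer of `x` in `M`. -/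
theorem Submodule.exists_commutator_add_commute (hKM : ∀ X ∈ K, ∀ y ∈ M,
      Complex.I • (X * y - y * X) ∈ M) (hMM : ∀ x ∈ M, ∀ y ∈ M, Complex.I • (x * y - y * x) ∈ K)
    (hM : ∀ x ∈ M, x.IsHermitian) {x y : Matrix ι ι ℂ} (hx : x ∈ M) (hy : y ∈ M) :
    ∃ X ∈ K, ∃ z ∈ M, Commute x z ∧ y = Complex.I • (X * x - x * X) + z := by
  let tr : Matrix ι ι ℂ →ₗ[ℝ] ℝ := Complex.reLm ∘ₗ Matrix.traceLinearMap ι ℝ ℂ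
  let β : M →ₗ[ℝ] Module.Dual ℝ M :=
    LinearMap.mk₂ ℝ (fun b c : M => tr ((c : Matrix ι ι ℂ) * b))
      (fun b b' c => by simp only [Submodule.coe_add, mul_add, map_add])
      (fun r b c => by simp only [Submodule.coe_smul, mul_smul_comm, map_smul])
      (fun b c c' => by simp only [Submodule.coe_add, add_mul, map_add])
      (fun r b c => by simp only [Submodule.coe_smul, smul_mul_assoc, map_smul])
  have hβ : ∀ b c : M, β b c = ((c : Matrix ι ι ℂ) * b).trace.re := fun b c => rfl
  have hβ0 : ∀ b : M, β b b = 0 → b = 0 := fun b hb =>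
    Subtype.ext ((hM b b.2).eq_zero_of_re_trace_mul_self hb)
  have hβsurj : Function.Surjective β := by
    rw [← LinearMap.injective_iff_surjective_of_finrank_eq_finrank Subspace.dual_finrank_eq.symm,
      ← LinearMap.ker_eq_bot, LinearMap.ker_eq_bot']
    intro b hb
    exact hβ0 b (by rw [hb, LinearMap.zero_apply])
  let R : Submodule ℝ M := Submodule.span ℝ
    ({c | ∃ X ∈ K, (c : Matrix ι ι ℂ) = Complex.I • (X * x - x * X)} ∪
      {c | Commute x (c : Matrix ι ι ℂ)})
  have hR : R = ⊤ := by
    -- A functional vanishing on `R` is the trace pairing with some `b ∈ M`. Orthogonality to `[K,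
    -- x]` makes `b` commute with `x`, so `b ∈ R` is orthogonal to itself.
    by_contra hne
    obtain ⟨φ, hφ, hφR⟩ := Submodule.exists_le_ker_of_lt_top R (lt_top_iff_ne_top.mpr hne)
    obtain ⟨b, rfl⟩ := hβsurj φ
    have hcomm : Commute x (b : Matrix ι ι ℂ) :=
      (hM x hx).commute_of_re_trace (hM b b.2) (K := K) (hMM x hx b b.2) fun X hX => by
        have := hφR (Submodule.subset_span (Or.inl ⟨X, hX, rfl⟩) :
          (⟨_, hKM X hX x hx⟩ : M) ∈ R)
        exact this
    have hbb := hφR (Submodule.subset_span (Or.inr hcomm) : b ∈ R)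
    exact hφ (by rw [hβ0 b hbb, map_zero])
  have hmem : (⟨y, hy⟩ : M) ∈ R := hR ▸ Submodule.mem_top
  suffices h : ∀ c ∈ R, ∃ X ∈ K, ∃ z ∈ M, Commute x z ∧
      (c : Matrix ι ι ℂ) = Complex.I • (X * x - x * X) + z from h _ hmem
  intro c hc
  induction hc using Submodule.span_induction with
  | mem c hc =>
    rcases hc with ⟨X, hX, hc⟩ | hc
    · exact ⟨X, hX, 0, M.zero_mem, Commute.zero_right x, by rw [hc, add_zero]⟩
    · exact ⟨0, K.zero_mem, c, c.2, hc, by simp⟩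
  | zero => exact ⟨0, K.zero_mem, 0, M.zero_mem, Commute.zero_right x, by simp⟩
  | add c c' _ _ h h' =>
    obtain ⟨X, hX, z, hz, hxz, h⟩ := h
    obtain ⟨X', hX', z', hz', hxz', h'⟩ := h'
    refine ⟨X + X', K.add_mem hX hX', z + z', M.add_mem hz hz', hxz.add_right hxz', ?_⟩
    rw [Submodule.coe_add, h, h']
    simp only [add_mul, mul_add, smul_sub, smul_add]
    abel
  | smul r c _ h =>
    obtain ⟨X, hX, z, hz, hxz, h⟩ := h
    refine ⟨r • X, K.smul_mem r hX, r • z, M.smul_mem r hz, hxz.smul_right r, ?_⟩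
    rw [Submodule.coe_smul, h]
    simp only [smul_mul_assoc, mul_smul_comm, smul_sub, smul_add, smul_comm r Complex.I]

/-- The orbits on `M` of the group generated by `exp (i K)` are closed. -/
theorem Matrix.exists_mem_conj_of_mem_closure (hKM : ∀ X ∈ K, ∀ y ∈ M,
      Complex.I • (X * y - y * X) ∈ M) (hMM : ∀ x ∈ M, ∀ y ∈ M, Complex.I • (x * y - y * x) ∈ K)
    (hK : ∀ x ∈ K, x.IsHermitian) (hM : ∀ x ∈ M, x.IsHermitian)
    {G : Subgroup (Matrix.unitaryGroup ι ℂ)}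
    (hKG : ∀ X ∈ K, ∃ U ∈ G, (U : Matrix ι ι ℂ) = NormedSpace.exp (Complex.I • X))
    (hGM : ∀ U ∈ G, ∀ y ∈ M, (U : Matrix ι ι ℂ) * y * (U : Matrix ι ι ℂ)ᴴ ∈ M)
    {x y : Matrix ι ι ℂ} (hx : x ∈ M) (hy : y ∈ M)
    (hxy : x ∈ closure ((fun U : Matrix.unitaryGroup ι ℂ =>
      (U : Matrix ι ι ℂ) * y * (U : Matrix ι ι ℂ)ᴴ) '' G)) :
    ∃ U ∈ G, (U : Matrix ι ι ℂ) * y * (U : Matrix ι ι ℂ)ᴴ = x := by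
  open scoped Matrix.Norms.Operator in
  let Z : Submodule ℝ (Matrix ι ι ℂ) :=
    { carrier := {z | z ∈ M ∧ Commute x z}
      add_mem' := fun h h' => ⟨M.add_mem h.1 h'.1, h.2.add_right h'.2⟩
      zero_mem' := ⟨M.zero_mem, Commute.zero_right x⟩
      smul_mem' := fun r z h => ⟨M.smul_mem r h.1, h.2.smul_right r⟩ }
  let J : Submodule ℝ (Matrix ι ι ℂ) := K.map (Complex.I • LinearMap.id)
  have hnear := Submodule.eventually_exists_exp_conj J M Z (fun z hz => hz.1)
    (by
      rintro _ ⟨X, hX, rfl⟩ z hz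
      have := hKM X hX z hz
      simpa only [LinearMap.smul_apply, LinearMap.id_apply, smul_mul_assoc, mul_smul_comm,
        ← smul_sub] using this)
    (x := x) ⟨hx, Commute.refl x⟩
    (by
      intro z hz
      obtain ⟨X, hX, w, hw, hxw, h⟩ := Submodule.exists_commutator_add_commute hKM hMM hM hx hz
      refine ⟨Complex.I • X, ⟨X, hX, rfl⟩, w, ⟨hw, hxw⟩, ?_⟩
      rw [h, smul_mul_assoc, mul_smul_comm, ← smul_sub])
    (hM x hx).eventually_eq_of_commute_of_spectrum_eq
  have hsub : (fun U : Matrix.unitaryGroup ι ℂ =>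
      (U : Matrix ι ι ℂ) * y * (U : Matrix ι ι ℂ)ᴴ) '' G ⊆ M := by
    rintro _ ⟨U, hU, rfl⟩
    exact hGM U hU y hy
  rw [eventually_nhdsWithin_iff] at hnear
  obtain ⟨_, ⟨U, hU, rfl⟩, hnearU⟩ := ((mem_closure_iff_frequently.mp hxy).and_eventually hnear).exists
  obtain ⟨_, ⟨X, hX, rfl⟩, z, ⟨hzM, hxz⟩, hzN, heq⟩ := hnearU (hsub ⟨U, hU, rfl⟩)
  obtain ⟨W, hW, hWX⟩ := hKG X hX
  -- `V` may lie outside `G`; it serves only to compare spectra.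
  obtain ⟨V, hV⟩ := Matrix.exists_unitary_conj_of_mem_closure hxy
  have heq' : (U : Matrix ι ι ℂ) * y * (U : Matrix ι ι ℂ)ᴴ =
      (W : Matrix ι ι ℂ) * z * (W : Matrix ι ι ℂ)ᴴ := by
    rw [Matrix.conjTranspose_eq_exp_neg (hK X hX) hWX, hWX]
    exact heq
  have hspec : spectrum ℂ z = spectrum ℂ x := by
    rw [← Matrix.spectrum_unitary_conj W z, ← heq', ← hV, Matrix.spectrum_unitary_conj,
      Matrix.spectrum_unitary_conj]
  have hzx : z = x := hzN (hM z hzM) hxz hspec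
  refine ⟨W⁻¹ * U, G.mul_mem (G.inv_mem hW) hU, ?_⟩
  have hWW : (W : Matrix ι ι ℂ)ᴴ * (W : Matrix ι ι ℂ) = 1 := Unitary.coe_star_mul_self W
  change (W : Matrix ι ι ℂ)ᴴ * (U : Matrix ι ι ℂ) * y *
    ((W : Matrix ι ι ℂ)ᴴ * (U : Matrix ι ι ℂ))ᴴ = x
  rw [Matrix.conjTranspose_mul, Matrix.conjTranspose_conjTranspose]
  calc (W : Matrix ι ι ℂ)ᴴ * (U : Matrix ι ι ℂ) * y * ((U : Matrix ι ι ℂ)ᴴ * (W : Matrix ι ι ℂ))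
      = (W : Matrix ι ι ℂ)ᴴ * (U * y * (U : Matrix ι ι ℂ)ᴴ) * W := by simp only [mul_assoc]
    _ = ((W : Matrix ι ι ℂ)ᴴ * W) * z * ((W : Matrix ι ι ℂ)ᴴ * W) := by
        rw [heq']; simp only [mul_assoc]
    _ = x := by rw [hWW, one_mul, mul_one, hzx]

/-- The closure of an orbit contains an element that commutes with a given `v ∈ M`: a maximizer of
the trace pairing with `v`. -/
theorem Matrix.exists_mem_closure_orbit_commute
    (hMM : ∀ x ∈ M, ∀ y ∈ M, Complex.I • (x * y - y * x) ∈ K)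
    (hK : ∀ x ∈ K, x.IsHermitian) (hM : ∀ x ∈ M, x.IsHermitian)
    {G : Subgroup (Matrix.unitaryGroup ι ℂ)}
    (hKG : ∀ X ∈ K, ∃ U ∈ G, (U : Matrix ι ι ℂ) = NormedSpace.exp (Complex.I • X))
    (hGM : ∀ U ∈ G, ∀ y ∈ M, (U : Matrix ι ι ℂ) * y * (U : Matrix ι ι ℂ)ᴴ ∈ M)
    {v y : Matrix ι ι ℂ} (hv : v ∈ M) (hy : y ∈ M) :
    ∃ x ∈ M, x ∈ closure ((fun U : Matrix.unitaryGroup ι ℂ =>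
      (U : Matrix ι ι ℂ) * y * (U : Matrix ι ι ℂ)ᴴ) '' G) ∧ Commute x v := by
  open scoped Matrix.Norms.Operator in
  set O := (fun U : Matrix.unitaryGroup ι ℂ =>
      (U : Matrix ι ι ℂ) * y * (U : Matrix ι ι ℂ)ᴴ) '' G with hO
  have hne : (closure O).Nonempty := ⟨_, subset_closure ⟨1, G.one_mem, rfl⟩⟩
  have hcont : Continuous fun x : Matrix ι ι ℂ => (x * v).trace.re :=
    Complex.continuous_re.comp (continuous_id.matrix_mul continuous_const).matrix_trace
  obtain ⟨x, hxO, hmax⟩ :=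
    (Matrix.isCompact_closure_unitary_orbit (G : Set _) y).exists_isMaxOn hne hcont.continuousOn
  have hxM : x ∈ M := by
    refine closure_minimal ?_ M.closed_of_finiteDimensional hxO
    rintro _ ⟨U, hU, rfl⟩
    exact hGM U hU y hy
  refine ⟨x, hxM, hxO, (hM x hxM).commute_of_re_trace (hM v hv) (K := K) (hMM x hxM v hv) ?_⟩
  intro X hX
  -- The closure is stable under `exp (i s X)`, so `s = 0` maximizes the pairing along this curve.
  have hinv : ∀ s : ℝ, NormedSpace.exp (s • (Complex.I • X)) * x *
      NormedSpace.exp (-(s • (Complex.I • X))) ∈ closure O := by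
    intro s
    obtain ⟨W, hW, hWX⟩ := hKG (s • X) (K.smul_mem s hX)
    have hWX' := Matrix.conjTranspose_eq_exp_neg (hK _ (K.smul_mem s hX)) hWX
    rw [smul_comm s, ← hWX, ← hWX']
    have hc : Continuous fun z : Matrix ι ι ℂ =>
      (W : Matrix ι ι ℂ) * z * (W : Matrix ι ι ℂ)ᴴ := by fun_prop
    refine map_mem_closure (f := fun z : Matrix ι ι ℂ =>
      (W : Matrix ι ι ℂ) * z * (W : Matrix ι ι ℂ)ᴴ) hc hxO ?_
    rintro _ ⟨U, hU, rfl⟩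
    refine ⟨W * U, G.mul_mem hW hU, ?_⟩
    simp only [Submonoid.coe_mul, Matrix.conjTranspose_mul, mul_assoc]
  let F : Matrix ι ι ℂ →L[ℝ] ℝ :=
    (Complex.reLm ∘ₗ Matrix.traceLinearMap ι ℝ ℂ ∘ₗ LinearMap.mulRight ℝ v).toContinuousLinearMap
  have hF : ∀ z, F z = (z * v).trace.re := fun z => rfl
  have hd := F.hasFDerivAt.comp_hasDerivAt (0 : ℝ) (hasDerivAt_exp_smul_conj (Complex.I • X) x)
  have hloc : IsLocalMax (F ∘ fun s : ℝ => NormedSpace.exp (s • (Complex.I • X)) * x *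
      NormedSpace.exp (-(s • (Complex.I • X)))) 0 := by
    refine Eventually.of_forall fun s => ?_
    have := hmax (hinv s)
    simpa [hF] using this
  have h0 := hloc.hasDerivAt_eq_zero hd
  have h1 : ((Complex.I • X * x - x * Complex.I • X) * v).trace.re = 0 := h0
  rwa [smul_mul_assoc Complex.I X x, mul_smul_comm Complex.I x X, ← smul_sub] at h1

/-- Every element of `M` is conjugate, under the group generated by `exp (i K)`, to an element of a
given maximal commuting subspace of `M`. -/
theorem Matrix.exists_conj_mem_maximal_commuting (hKM : ∀ X ∈ K, ∀ y ∈ M,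
      Complex.I • (X * y - y * X) ∈ M) (hMM : ∀ x ∈ M, ∀ y ∈ M, Complex.I • (x * y - y * x) ∈ K)
    (hK : ∀ x ∈ K, x.IsHermitian) (hM : ∀ x ∈ M, x.IsHermitian)
    {G : Subgroup (Matrix.unitaryGroup ι ℂ)}
    (hKG : ∀ X ∈ K, ∃ U ∈ G, (U : Matrix ι ι ℂ) = NormedSpace.exp (Complex.I • X))
    (hGM : ∀ U ∈ G, ∀ y ∈ M, (U : Matrix ι ι ℂ) * y * (U : Matrix ι ι ℂ)ᴴ ∈ M)
    {𝔞 : Submodule ℝ (Matrix ι ι ℂ)} (haM : 𝔞 ≤ M) (hcomm : ∀ x ∈ 𝔞, ∀ y ∈ 𝔞, Commute x y)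
    (hmax : ∀ x ∈ M, (∀ y ∈ 𝔞, Commute x y) → x ∈ 𝔞) {y : Matrix ι ι ℂ} (hy : y ∈ M) :
    ∃ U ∈ G, ∃ x ∈ 𝔞, y = (U : Matrix ι ι ℂ) * x * (U : Matrix ι ι ℂ)ᴴ := by
  obtain ⟨v, hv, hvcomm⟩ := 𝔞.exists_commutant_eq (fun x hx => hM x (haM hx)) hcomm
  obtain ⟨x, hxM, hxO, hxv⟩ :=
    Matrix.exists_mem_closure_orbit_commute hMM hK hM hKG hGM (haM hv) hy
  obtain ⟨U, hU, rfl⟩ :=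
    Matrix.exists_mem_conj_of_mem_closure hKM hMM hK hM hKG hGM hxM hy hxO
  refine ⟨U⁻¹, G.inv_mem hU, _, hmax _ hxM (hvcomm _ hxv), ?_⟩
  have hUU : (U : Matrix ι ι ℂ)ᴴ * (U : Matrix ι ι ℂ) = 1 := Unitary.coe_star_mul_self U
  change y = (U : Matrix ι ι ℂ)ᴴ * (U * y * (U : Matrix ι ι ℂ)ᴴ) * (U : Matrix ι ι ℂ)ᴴᴴ
  rw [Matrix.conjTranspose_conjTranspose]
  calc y = ((U : Matrix ι ι ℂ)ᴴ * U) * y * ((U : Matrix ι ι ℂ)ᴴ * U) := by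
        rw [hUU, one_mul, mul_one]
    _ = _ := by simp only [mul_assoc]

/-- Conjugation by the group generated by `exp (i K)` preserves `M`. -/
theorem Matrix.conj_mem_of_mem_closure_exp (hKM : ∀ X ∈ K, ∀ y ∈ M,
      Complex.I • (X * y - y * X) ∈ M) (hK : ∀ x ∈ K, x.IsHermitian)
    {U : Matrix.unitaryGroup ι ℂ} (hU : U ∈ Subgroup.closure {U : Matrix.unitaryGroup ι ℂ |
      ∃ X ∈ K, (U : Matrix ι ι ℂ) = NormedSpace.exp (Complex.I • X)}) :
    ∀ y ∈ M, (U : Matrix ι ι ℂ) * y * (U : Matrix ι ι ℂ)ᴴ ∈ M := by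
  open scoped Matrix.Norms.Operator in
  have hexp : ∀ X ∈ K, ∀ y ∈ M,
      NormedSpace.exp (Complex.I • X) * y * NormedSpace.exp (-(Complex.I • X)) ∈ M := by
    intro X hX y hy
    refine M.exp_mul_mul_exp_neg_mem (fun z hz => ?_) hy
    rw [smul_mul_assoc, mul_smul_comm, ← smul_sub]
    exact hKM X hX z hz
  induction hU using Subgroup.closure_induction'' with
  | mem U hU =>
    obtain ⟨X, hX, hU⟩ := hU
    intro y hy
    rw [Matrix.conjTranspose_eq_exp_neg (hK X hX) hU, hU]
    exact hexp X hX y hy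
  | inv_mem U hU =>
    obtain ⟨X, hX, hU⟩ := hU
    intro y hy
    change (U : Matrix ι ι ℂ)ᴴ * y * (U : Matrix ι ι ℂ)ᴴᴴ ∈ M
    rw [Matrix.conjTranspose_conjTranspose, Matrix.conjTranspose_eq_exp_neg (hK X hX) hU, hU]
    have := hexp (-X) (K.neg_mem hX) y hy
    rwa [smul_neg, neg_neg] at this
  | one =>
    intro y hy
    simpa using hy
  | mul U V _ _ hU hV =>
    intro y hy
    have := hU _ (hV y hy)
    simpa only [Submonoid.coe_mul, Matrix.conjTranspose_mul, mul_assoc] using this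

end SymmetricPair

/-! ### Transfer to the Lie algebra. -/

theorem theorem1 {ι : Type*} [Fintype ι] [DecidableEq ι]
    (𝔤 : LieSubalgebra ℝ (HermitianMatrix ι))
    (B : LinearMap.BilinForm ℝ 𝔤) (hBnondeg : B.Nondegenerate) (hBinv : B.lieInvariant 𝔤)
    (𝔨 𝔪 𝔥 : Submodule ℝ 𝔤)
    (hCartan : IsCartanDecomposition B 𝔨 𝔪) (h𝔥 : IsCartanSubalgebraIn 𝔪 𝔥)
    (m : 𝔤) (hm : m ∈ 𝔪) :
    ∃ K ∈ expGroup 𝔨, ∃ h ∈ 𝔥,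
      ((m : HermitianMatrix ι) : Matrix ι ι ℂ) =
        (K : Matrix ι ι ℂ) * ((h : HermitianMatrix ι) : Matrix ι ι ℂ)
          * Matrix.conjTranspose (K : Matrix ι ι ℂ) ∧
      ∀ t : ℝ,
        NormedSpace.exp (-(Complex.I * (t : ℂ)) • ((m : HermitianMatrix ι) : Matrix ι ι ℂ)) =
          (K : Matrix ι ι ℂ)
            * NormedSpace.exp (-(Complex.I * (t : ℂ)) • ((h : HermitianMatrix ι) : Matrix ι ι ℂ))
            * Matrix.conjTranspose (K : Matrix ι ι ℂ) := by
  let φ : 𝔤 →ₗ[ℝ] Matrix ι ι ℂ :=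
    (selfAdjoint.submodule ℝ (Matrix ι ι ℂ)).subtype ∘ₗ 𝔤.toSubmodule.subtype
  have hφ : ∀ x y : 𝔤, φ ⁅x, y⁆ = Complex.I • (φ x * φ y - φ y * φ x) := fun x y => rfl
  have hφinj : Function.Injective φ := fun x y h => Subtype.ext (Subtype.ext h)
  have hherm : ∀ (p : Submodule ℝ 𝔤), ∀ x ∈ p.map φ, x.IsHermitian := by
    rintro p _ ⟨x, -, rfl⟩
    exact x.1.2
  have hcomm : ∀ x y : 𝔤, ⁅x, y⁆ = 0 ↔ Commute (φ x) (φ y) := by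
    intro x y
    rw [← hφinj.eq_iff, hφ, map_zero, smul_eq_zero, or_iff_right Complex.I_ne_zero, sub_eq_zero]
    rfl
  have hKM : ∀ X ∈ 𝔨.map φ, ∀ y ∈ 𝔪.map φ, Complex.I • (X * y - y * X) ∈ 𝔪.map φ := by
    rintro _ ⟨X, hX, rfl⟩ _ ⟨y, hy, rfl⟩
    exact ⟨_, hCartan.lie_mem_compl X hX y hy, rfl⟩
  have hMM : ∀ x ∈ 𝔪.map φ, ∀ y ∈ 𝔪.map φ, Complex.I • (x * y - y * x) ∈ 𝔨.map φ := by
    rintro _ ⟨x, hx, rfl⟩ _ ⟨y, hy, rfl⟩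
    exact ⟨_, hCartan.lie_mem_of_mem_compl_of_mem_compl x hx y hy, rfl⟩
  have hG : expGroup 𝔨 = Subgroup.closure {U : Matrix.unitaryGroup ι ℂ |
      ∃ X ∈ 𝔨.map φ, (U : Matrix ι ι ℂ) = NormedSpace.exp (Complex.I • X)} := by
    refine congrArg Subgroup.closure (Set.ext fun U => ⟨?_, ?_⟩)
    · rintro ⟨X, hX, hU⟩
      exact ⟨φ X, ⟨X, hX, rfl⟩, hU⟩
    · rintro ⟨_, ⟨X, hX, rfl⟩, hU⟩
      exact ⟨X, hX, hU⟩
  have hmax : ∀ x ∈ 𝔪, (∀ y ∈ 𝔥, ⁅x, y⁆ = 0) → x ∈ 𝔥 := by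
    intro x hx hxy
    have hyx : ∀ y ∈ 𝔥, ⁅y, x⁆ = 0 := fun y hy => by rw [← lie_skew, hxy y hy, neg_zero]
    -- Maximality is applied to `𝔥 + ℝx`, which is again Abelian and inside `𝔪`.
    refine h𝔥.2 (y := 𝔥 ⊔ Submodule.span ℝ {x}) ⟨sup_le h𝔥.1.1 ?_, ?_⟩ le_sup_left
      (Submodule.mem_sup_right (Submodule.mem_span_singleton_self x))
    · rwa [Submodule.span_singleton_le_iff_mem]
    · intro a ha b hb
      obtain ⟨a, ha', _, ha'', rfl⟩ := Submodule.mem_sup.mp ha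
      obtain ⟨b, hb', _, hb'', rfl⟩ := Submodule.mem_sup.mp hb
      obtain ⟨r, rfl⟩ := Submodule.mem_span_singleton.mp ha''
      obtain ⟨s, rfl⟩ := Submodule.mem_span_singleton.mp hb''
      simp [h𝔥.1.2 a ha' b hb', hxy b hb', hyx a ha']
  obtain ⟨U, hU, _, ⟨h, hh, rfl⟩, hmU⟩ := Matrix.exists_conj_mem_maximal_commuting hKM hMM
    (hherm 𝔨) (hherm 𝔪) (G := expGroup 𝔨)
    (by
      intro X hX
      refine ⟨⟨_, (hherm 𝔨 X hX).exp_smul_I_mem_unitaryGroup⟩, ?_, rfl⟩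
      rw [hG]
      exact Subgroup.subset_closure ⟨X, hX, rfl⟩)
    (by
      intro U hU
      rw [hG] at hU
      exact Matrix.conj_mem_of_mem_closure_exp hKM (hherm 𝔨) hU)
    (𝔞 := 𝔥.map φ) (Submodule.map_mono h𝔥.1.1)
    (by
      rintro _ ⟨x, hx, rfl⟩ _ ⟨y, hy, rfl⟩
      exact (hcomm x y).mp (h𝔥.1.2 x hx y hy))
    (by
      rintro _ ⟨x, hx, rfl⟩ hxy
      exact ⟨x, hmax x hx fun y hy => (hcomm x y).mpr (hxy _ ⟨y, hy, rfl⟩), rfl⟩)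
    (y := φ m) ⟨m, hm, rfl⟩
  refine ⟨U, hU, h, hh, hmU, fun t => ?_⟩
  -- The exponential commutes with conjugation, so the same `U` and `h` serve every `t`.
  have hconj := Matrix.exp_units_conj (Unitary.toUnits U)
    (-(Complex.I * (t : ℂ)) • ((h : HermitianMatrix ι) : Matrix ι ι ℂ))
  rw [mul_smul_comm, smul_mul_assoc] at hconj
  change φ m = U * φ h * (U : Matrix ι ι ℂ)ᴴ at hmU
  change NormedSpace.exp (_ • φ m) = _
  rw [hmU]
  exact hconj
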